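/- **Conventions.** $\mathrm{PSL}_2(\mathbb C)$ acts on the Riemann sphere $\overline{\mathbb C}$ by Möbius transformations. For a discrete subgroup $\Gamma\subset\mathrm{PSL}_2(\mathbb C)$, $\Omega(\Gamma)$ is the largest open subset of $\overline{\mathbb C}$ on which $\Gamma$ acts properly discontinuously, and $\Lambda(\Gamma)=\overline{\mathbb C}-\Omega(\Gamma)$. A set $X\subset\overline{\mathbb C}$ is *precisely invariant* under a subgroup $\Phi$ of $\Gamma$ if $\{\gamma\in\Gamma:\gamma(X)=X\}=\Phi$ and $X\cap\gamma(X)=\emptyset$ for all $\gamma\in\Gamma-\Phi$. A *cusp region* for a parabolic element $\gamma\in\Gamma$ (with $\Gamma$ discrete and torsion-free) is a closed Jordan domain $D\subset\overline{\mathbb C}$ which is precisely invariant under $\langle\gamma\rangle$ in $\Gamma$ and meets $\Lambda(\Gamma)$ exactly in the fixed point of $\gamma$. A sequence of sets $X_j$ *converges* to $X$ if every point of $X$ is the limit of some sequence $x_j\in X_j$, and every accumulation point of every sequence $x_j\in X_j$ lies in $X$. For a group $G$, $\mathcal D(G)$ denotes the set of discrete faithful representations $G\to\mathrm{PSL}_2(\mathbb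 C)$. A sequence $\{\rho_j\}\subset\mathcal D(G)$ *converges strongly* to $\rho\in\mathcal D(G)$ if $\rho_j(g)\to\rho(g)$ for every $g\in G$ and $\rho_j(G)$ converges to $\rho(G)$ as subsets of $\mathrm{PSL}_2(\mathbb C)$; it is *type-preserving* if, for all $j$ and all $g\in G$, $\rho_j(g)$ is parabolic if and only if $\rho(g)$ is parabolic. *Normalizing* $\{\rho_j\}$ about $\rho(h)$ means choosing Möbius transformations $\beta_j$ converging to the identity with $\beta_j\rho_j(h)\beta_j^{-1}=\rho(h)$ for all $j$, and replacing each $\rho_j$ by $\beta_j\rho_j\beta_j^{-1}$. **Lemma.** Let $G$ be a finitely generated, torsion-free, non-abelian group, and let $\{\rho_j\}\subset\mathcal D(G)$ be a type-preserving sequence converging strongly to $\rho\in\mathcal D(G)$ such that $\Lambda(\rho_j(G))$ converges to $\Lambda(\rho(G))$. Let $h\in G$ be such that $\rho(h)$ is a primitive parabolic element of $\rho(G)$ (that is, not a proper power in $\rho(G)$), let $D$ be a cusp region for $\rho(h)$ in $\rho(G)$, and set $c=\partial D\cap\Omega(\rho(G))$. Let $\{\rho_j'\}$, $\rho_j'=\beta_j\rho_j\beta_j^{-1}$,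 be a sequence obtained by normalizing $\{\rho_j\}$ about $\rho(h)$. Then, for all sufficiently large $j$, the set $c$ lies in $\Omega(\rho_j'(G))$ and is precisely invariant under $\langle\rho_j'(h)\rangle$ in $\rho_j'(G)$. -/

import Mathlib

open Filter Topology
open scoped Pointwise MatrixGroups

/-- The Möbius action of `PSL(2, ℂ)` on the Riemann sphere `ℂ ∪ {∞}`, transported from
Mathlib's action on the complex projective line. -/
noncomputable instance moebiusAction : MulAction PSL(2, ℂ) (OnePoint ℂ) :=
  (OnePoint.equivProjectivization ℂ).mulAction PSL(2, ℂ)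

/-- The action on the sphere is `z ↦ (a z + b) / (c z + d)`: a matrix acts through its class in
`PSL(2, ℂ)` exactly as Mathlib's `GL (Fin 2) ℂ` acts on `OnePoint ℂ`. -/
theorem moebiusAction_mk_smul (g : SL(2, ℂ)) (z : OnePoint ℂ) :
    (QuotientGroup.mk g : PSL(2, ℂ)) • z = (g : GL (Fin 2) ℂ) • z := by
  rfl

/-- A Möbius transformation is parabolic if it is represented by a nonscalar matrix with a double
eigenvalue (equivalently: it is not the identity and its trace is `± 2`). -/
def IsParabolicMoebius (γ : PSL(2, ℂ)) : Prop :=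
  ∃ g : SL(2, ℂ), (QuotientGroup.mk g : PSL(2, ℂ)) = γ ∧
    (g : Matrix (Fin 2) (Fin 2) ℂ).IsParabolic

section Action

variable {M X : Type*} [Group M] [MulAction M X] [TopologicalSpace X]

/-- `Γ` preserves the set `W` and acts properly discontinuously on it. -/
def ActsProperlyDiscontinuouslyOn (Γ : Subgroup M) (W : Set X) : Prop :=
  (∀ γ ∈ Γ, γ • W = W) ∧
    ∀ K : Set X, IsCompact K → K ⊆ W → {γ : M | γ ∈ Γ ∧ (γ • K ∩ K).Nonempty}.Finite

/-- The domain of discontinuity `Ω(Γ)`: the largest open set on which `Γ` acts properly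
discontinuously, that is, the union of all of these sets. -/
def domainOfDiscontinuity (X : Type*) [MulAction M X] [TopologicalSpace X] (Γ : Subgroup M) :
    Set X :=
  ⋃₀ {W : Set X | IsOpen W ∧ ActsProperlyDiscontinuouslyOn Γ W}

/-- The limit set `Λ(Γ)`. -/
def limitSet (X : Type*) [MulAction M X] [TopologicalSpace X] (Γ : Subgroup M) : Set X :=
  (domainOfDiscontinuity X Γ)ᶜ

end Action

/-- `Y` is precisely invariant under the subgroup `Φ` of `Γ`: the stabilizer of `Y` in `Γ` is `Φ`,
and `Y` is disjoint from its translates by the elements of `Γ - Φ`. -/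
def IsPreciselyInvariant {M X : Type*} [Group M] [MulAction M X] (Y : Set X)
    (Φ Γ : Subgroup M) : Prop :=
  Γ ⊓ MulAction.stabilizer M Y = Φ ∧ ∀ γ ∈ Γ, γ ∉ Φ → Y ∩ γ • Y = ∅

/-- `γ` is an element of `Γ` that is not a proper power of an element of `Γ`. -/
def IsPrimitiveIn {M : Type*} [Group M] (γ : M) (Γ : Subgroup M) : Prop :=
  γ ∈ Γ ∧ ∀ δ ∈ Γ, ∀ n : ℤ, δ ^ n = γ → n = 1 ∨ n = -1

section Convergence

/-- Convergence of a sequence of (closed) subsets: every point of `A` is the limit of a sequence of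
points `a j ∈ As j`, and every accumulation point of such a sequence lies in `A`. -/
def SetsConverge {X : Type*} [TopologicalSpace X] (As : ℕ → Set X) (A : Set X) : Prop :=
  (∀ x ∈ A, ∃ a : ℕ → X, (∀ j, a j ∈ As j) ∧ Tendsto a atTop (𝓝 x)) ∧
    ∀ a : ℕ → X, (∀ j, a j ∈ As j) → ∀ x, MapClusterPt x atTop a → x ∈ A

variable {G : Type*} [Group G]

/-- The space of discrete faithful representations of `G` into `PSL(2, ℂ)`. -/
def discreteFaithfulReps (G : Type*) [Group G] : Set (G →* PSL(2, ℂ)) :=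
  {ρ | Function.Injective ρ ∧ DiscreteTopology ρ.range}

def ConvergesAlgebraically (ρs : ℕ → G →* PSL(2, ℂ)) (ρ : G →* PSL(2, ℂ)) : Prop :=
  ∀ g, Tendsto (fun j => ρs j g) atTop (𝓝 (ρ g))

/-- Geometric convergence of a sequence of subgroups of `PSL(2, ℂ)`. -/
def ConvergesGeometrically (Γs : ℕ → Subgroup PSL(2, ℂ)) (Γ : Subgroup PSL(2, ℂ)) : Prop :=
  SetsConverge (fun j => (Γs j : Set PSL(2, ℂ))) (Γ : Set PSL(2, ℂ))

def ConvergesStrongly (ρs : ℕ → G →* PSL(2, ℂ)) (ρ : G →* PSL(2, ℂ)) : Prop :=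
  ConvergesAlgebraically ρs ρ ∧ ConvergesGeometrically (fun j => (ρs j).range) ρ.range

/-- Each isomorphism `ρs j ∘ ρ⁻¹ : ρ(G) → ρs j (G)` preserves parabolicity in both directions. -/
def IsTypePreserving (ρs : ℕ → G →* PSL(2, ℂ)) (ρ : G →* PSL(2, ℂ)) : Prop :=
  ∀ j g, IsParabolicMoebius (ρ g) ↔ IsParabolicMoebius (ρs j g)

/-- The sequence `ρs'` arises by normalizing the sequence `ρs` about `ρ(h)`: its terms are the
conjugates `β j * ρs j * (β j)⁻¹` by Möbius transformations `β j` converging to the identity, and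
`ρs' j h = ρ h` for all `j`. -/
def IsNormalizationAbout (ρs' ρs : ℕ → G →* PSL(2, ℂ)) (ρ : G →* PSL(2, ℂ)) (h : G) : Prop :=
  ∃ β : ℕ → PSL(2, ℂ), Tendsto β atTop (𝓝 1) ∧
    (∀ j g, ρs' j g = β j * ρs j g * (β j)⁻¹) ∧ ∀ j, ρs' j h = ρ h

end Convergence

/-- A Jordan curve: the image of the circle under a continuous injective map. -/
def IsJordanCurve {X : Type*} [TopologicalSpace X] (C : Set X) : Prop :=
  ∃ f : Circle → X, Continuous f ∧ Function.Injective f ∧ Set.range f = C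

/-- A closed Jordan domain in the Riemann sphere: the closure of its interior, where the interior
is nonempty and connected, and the boundary is a Jordan curve. -/
def IsClosedJordanDomain (D : Set (OnePoint ℂ)) : Prop :=
  closure (interior D) = D ∧ IsConnected (interior D) ∧ IsJordanCurve (frontier D)

/-- `D` is a cusp region for the parabolic element `γ` of `Γ`. -/
structure IsCuspRegion (D : Set (OnePoint ℂ)) (γ : PSL(2, ℂ)) (Γ : Subgroup PSL(2, ℂ)) :
    Prop where
  mem : γ ∈ Γ
  parabolic : IsParabolicMoebius γ
  jordan : IsClosedJordanDomain D
  preciselyInvariant : IsPreciselyInvariant D (Subgroup.zpowers γ) Γ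
  inter_limitSet : D ∩ limitSet (OnePoint ℂ) Γ = MulAction.fixedBy (OnePoint ℂ) γ

/-!
The argument takes place on the Riemann sphere and uses no hyperbolic geometry.

Write `Γ = ρ(G)`, `Γⱼ = ρⱼ'(G)`, `γ = ρ(h) = ρⱼ'(h)`, and let `p` be the fixed point of `γ`. Since
the conjugating maps tend to the identity, `Γⱼ → Γ` geometrically and `Λ(Γⱼ) → Λ(Γ)`
(`SetsConverge.image_of_tendsto`). The set `c` is `∂D \ {p}`, and it is covered by the translates of
a compact set `K ⊆ c` under the powers of `γ`
(`IsJordanCurve.exists_isCompact_zpow_smul_mem`): a Jordan curve through `p` minus `p` is a line on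
which `γ` acts without fixed points.

As `K` is compact and misses `Λ(Γ)`, it misses `Λ(Γⱼ)` for large `j`, hence so does `c`. If precise
invariance fails for infinitely many `j`, then multiplication by powers of `γ` provides
`gⱼ ∈ Γⱼ \ ⟨γ⟩` and points `xⱼ, gⱼ xⱼ ∈ K`. There are two cases, which are separated along an
ultrafilter on the bad indices.

* If matrices of the `gⱼ` tend to infinity, then, rescaled, they tend to a matrix of rank one. So
  `gⱼ` tends to a constant away from a single point, and both that constant and that point lie in
  `Λ(Γ)` because `Λ(Γ)` has at least two points and is the limit of the invariant sets `Λ(Γⱼ)`. Then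
  `xⱼ` or `gⱼ xⱼ` tends to a point of `Λ(Γ)`, whereas `K` is disjoint from it
  (`not_tendsto_norm_atTop`).
* Otherwise `gⱼ` tends to some `g ∈ Γ` that carries a point of `K` to a point of `K`. Precise
  invariance of `D` gives `g = γ ^ n`, so that the nontrivial elements `γ ^ (-n) gⱼ` of `Γⱼ` tend to
  `1`. This is impossible, because their powers leave every small compact neighbourhood of `1`, in
  ever smaller steps, whereas the discrete group `Γ` has no point near `1` to which the powers could
  tend on the way out (`eventually_eq_one_of_tendsto_one`).

That `Λ(Γ)` has at least two points is where `G` being torsion-free and non-abelian enters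
(`exists_mem_limitSet_ne`).
-/

open scoped Matrix

/-! ### Homogeneous coordinates on the Riemann sphere -/

/-- The point `v 0 / v 1` of the Riemann sphere with homogeneous coordinates `v`; the junk value at
`v = 0` is `∞`. -/
noncomputable def ofHomogeneous (v : Fin 2 → ℂ) : OnePoint ℂ :=
  if v 1 = 0 then OnePoint.infty else ((v 0 / v 1 : ℂ) : OnePoint ℂ)

lemma equivProjectivization_symm_mk (v : Fin 2 → ℂ) (hv : v ≠ 0) :
    (OnePoint.equivProjectivization ℂ).symm (Projectivization.mk ℂ v hv) = ofHomogeneous v := by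
  rw [OnePoint.equivProjectivization_symm_apply_mk]
  simp [ofHomogeneous, div_eq_inv_mul]

lemma ofHomogeneous_eq_iff {v w : Fin 2 → ℂ} (hv : v ≠ 0) (hw : w ≠ 0) :
    ofHomogeneous v = ofHomogeneous w ↔ v 0 * w 1 = w 0 * v 1 := by
  have key : ∀ u : Fin 2 → ℂ, u ≠ 0 → u 1 = 0 → u 0 ≠ 0 := by
    intro u hu h1 h0
    exact hu (funext fun i => by fin_cases i <;> assumption)
  by_cases hv1 : v 1 = 0 <;> by_cases hw1 : w 1 = 0
  · simp [ofHomogeneous, hv1, hw1]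
  · simp [ofHomogeneous, hv1, hw1, key v hv hv1]
  · simp [ofHomogeneous, hv1, hw1, key w hw hw1]
  · simp [ofHomogeneous, hv1, hw1, div_eq_div_iff]

lemma ofHomogeneous_smul {c : ℂ} (hc : c ≠ 0) (v : Fin 2 → ℂ) :
    ofHomogeneous (c • v) = ofHomogeneous v := by
  simp [ofHomogeneous, hc, mul_div_mul_left]

lemma exists_norm_eq_one_ofHomogeneous_eq (x : OnePoint ℂ) :
    ∃ v : Fin 2 → ℂ, ‖v‖ = 1 ∧ ofHomogeneous v = x := by
  obtain ⟨v, hv, rfl⟩ : ∃ v : Fin 2 → ℂ, v ≠ 0 ∧ ofHomogeneous v = x := by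
    induction x using OnePoint.rec with
    | infty => exact ⟨![1, 0], by simp, by simp [ofHomogeneous]⟩
    | coe z => exact ⟨![z, 1], by simp, by simp [ofHomogeneous]⟩
  refine ⟨((‖v‖⁻¹ : ℝ) : ℂ) • v, ?_, ofHomogeneous_smul (by simpa using hv) v⟩
  rw [norm_smul, Complex.norm_real, norm_inv, norm_norm, inv_mul_cancel₀ (norm_ne_zero_iff.2 hv)]

lemma continuousAt_ofHomogeneous {v : Fin 2 → ℂ} (hv : v ≠ 0) : ContinuousAt ofHomogeneous v := by
  by_cases h1 : v 1 = 0
  · have h0 : v 0 ≠ 0 := fun h0 => hv (funext fun i => by fin_cases i <;> assumption)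
    rw [ContinuousAt, show ofHomogeneous v = OnePoint.infty by simp [ofHomogeneous, h1],
      OnePoint.hasBasis_nhds_infty.tendsto_right_iff]
    rintro s ⟨-, hs⟩
    obtain ⟨R, hR⟩ := hs.isBounded.exists_norm_le
    have hev : ∀ᶠ w : Fin 2 → ℂ in 𝓝 v, R * ‖w 1‖ < ‖w 0‖ := by
      refine ContinuousAt.eventually_lt (Continuous.continuousAt (by fun_prop))
        (Continuous.continuousAt (by fun_prop)) ?_
      simpa [h1] using h0
    filter_upwards [hev] with w hw
    by_cases hw1 : w 1 = 0
    · simp [ofHomogeneous, hw1]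
    · left
      refine ⟨w 0 / w 1, fun hmem => ?_, by simp [ofHomogeneous, hw1]⟩
      have := hR _ hmem
      rw [norm_div, div_le_iff₀ (norm_pos_iff.2 hw1)] at this
      linarith
  · have hev : ∀ᶠ w : Fin 2 → ℂ in 𝓝 v, w 1 ≠ 0 :=
      (continuous_apply 1).continuousAt.eventually_ne h1
    have hc : ContinuousAt (fun w : Fin 2 → ℂ => ((w 0 / w 1 : ℂ) : OnePoint ℂ)) v :=
      OnePoint.continuous_coe.continuousAt.comp
        ((continuous_apply 0).continuousAt.div (continuous_apply 1).continuousAt h1)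
    refine hc.congr ?_
    filter_upwards [hev] with w hw
    simp [ofHomogeneous, hw]

lemma SL_mulVec_ne_zero (A : SL(2, ℂ)) {v : Fin 2 → ℂ} (hv : v ≠ 0) :
    (A : Matrix (Fin 2) (Fin 2) ℂ) *ᵥ v ≠ 0 := by
  intro h
  refine hv (Matrix.eq_zero_of_mulVec_eq_zero ?_ h)
  simp

lemma mk_smul_ofHomogeneous (A : SL(2, ℂ)) {v : Fin 2 → ℂ} (hv : v ≠ 0) :
    (QuotientGroup.mk A : PSL(2, ℂ)) • ofHomogeneous v =
      ofHomogeneous ((A : Matrix (Fin 2) (Fin 2) ℂ) *ᵥ v) := by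
  rw [moebiusAction_mk_smul, ← equivProjectivization_symm_mk v hv,
    ← equivProjectivization_symm_mk _ (SL_mulVec_ne_zero A hv), Equiv.smul_def,
    Equiv.apply_symm_apply]
  rfl

/-! ### The topological group `PSL(2, ℂ)` -/

instance : LocallyCompactSpace SL(2, ℂ) :=
  have : LocallyCompactSpace (Matrix (Fin 2) (Fin 2) ℂ) :=
    inferInstanceAs (LocallyCompactSpace (Fin 2 → Fin 2 → ℂ))
  Matrix.SpecialLinearGroup.isClosedEmbedding_val.locallyCompactSpace

instance : LocallyCompactSpace PSL(2, ℂ) :=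
  inferInstanceAs (LocallyCompactSpace (SL(2, ℂ) ⧸ Subgroup.center SL(2, ℂ)))

instance : T2Space PSL(2, ℂ) := by
  have : IsClosed (Subgroup.center SL(2, ℂ) : Set SL(2, ℂ)) := by
    have h : (Subgroup.center SL(2, ℂ) : Set SL(2, ℂ)) = ⋂ g, {z | g * z = z * g} := by
      ext z
      simp [Subgroup.mem_center_iff]
    rw [h]
    exact isClosed_iInter fun g => isClosed_eq (by fun_prop) (by fun_prop)
  have : T3Space (SL(2, ℂ) ⧸ Subgroup.center SL(2, ℂ)) := inferInstance
  exact inferInstanceAs (T2Space (SL(2, ℂ) ⧸ Subgroup.center SL(2, ℂ)))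

instance : ContinuousSMul PSL(2, ℂ) (OnePoint ℂ) where
  continuous_smul := by
    -- Pull the action back along `SL(2, ℂ) × S³ → PSL(2, ℂ) × OnePoint ℂ`, where it is linear.
    let q : Metric.sphere (0 : Fin 2 → ℂ) 1 → OnePoint ℂ := fun v => ofHomogeneous v
    have hne : ∀ v : Metric.sphere (0 : Fin 2 → ℂ) 1, (v : Fin 2 → ℂ) ≠ 0 :=
      fun v => ne_zero_of_mem_unit_sphere v
    have hq : Continuous q := continuous_iff_continuousAt.2 fun v =>
      (continuousAt_ofHomogeneous (hne v)).comp continuous_subtype_val.continuousAt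
    have hqs : Function.Surjective q := fun x => by
      obtain ⟨v, hv, rfl⟩ := exists_norm_eq_one_ofHomogeneous_eq x
      exact ⟨⟨v, by simpa using hv⟩, rfl⟩
    have h1 : IsQuotientMap (Prod.map (id : SL(2, ℂ) → SL(2, ℂ)) q) :=
      (isProperMap_id.prodMap hq.isProperMap).isClosedMap.isQuotientMap
        (continuous_id.prodMap hq) (Function.surjective_id.prodMap hqs)
    have h2 : IsQuotientMap (Prod.map (QuotientGroup.mk : SL(2, ℂ) → PSL(2, ℂ))
        (id : OnePoint ℂ → OnePoint ℂ)) :=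
      (QuotientGroup.isOpenQuotientMap_mk.prodMap IsOpenQuotientMap.id).isQuotientMap
    rw [(h2.comp h1).continuous_iff]
    have : (fun p : PSL(2, ℂ) × OnePoint ℂ => p.1 • p.2) ∘
        (Prod.map (QuotientGroup.mk : SL(2, ℂ) → PSL(2, ℂ)) (id : OnePoint ℂ → OnePoint ℂ) ∘
          Prod.map (id : SL(2, ℂ) → SL(2, ℂ)) q) =
        fun p => ofHomogeneous ((p.1 : Matrix (Fin 2) (Fin 2) ℂ) *ᵥ (p.2 : Fin 2 → ℂ)) := by
      ext1 p
      exact mk_smul_ofHomogeneous p.1 (hne p.2)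
    rw [this]
    refine continuous_iff_continuousAt.2 fun p => ?_
    refine ContinuousAt.comp (f := fun p : SL(2, ℂ) × Metric.sphere (0 : Fin 2 → ℂ) 1 =>
      (p.1 : Matrix (Fin 2) (Fin 2) ℂ) *ᵥ (p.2 : Fin 2 → ℂ))
      (continuousAt_ofHomogeneous (SL_mulVec_ne_zero p.1 (hne p.2))) ?_
    exact ((continuous_subtype_val.comp continuous_fst).matrix_mulVec
      (continuous_subtype_val.comp continuous_snd)).continuousAt

/-! ### Convergence of sets along a finer filter -/

/-- It suffices that `a j ∈ As j` along the filter `F`: elsewhere `a` may be changed, since the sets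
`As j` are nonempty. -/
lemma SetsConverge.mem_of_tendsto {X : Type*} [TopologicalSpace X] {As : ℕ → Set X} {A : Set X}
    (h : SetsConverge As A) (hne : ∀ j, (As j).Nonempty) {F : Filter ℕ} [F.NeBot]
    (hF : F ≤ atTop) {a : ℕ → X} (ha : ∀ᶠ j in F, a j ∈ As j) {x : X} (hx : Tendsto a F (𝓝 x)) :
    x ∈ A := by
  classical
  choose b hb using hne
  refine h.2 (fun j => if a j ∈ As j then a j else b j) (fun j => ?_) x ?_
  · split_ifs with hj
    exacts [hj, hb j]
  · have : Tendsto (fun j => if a j ∈ As j then a j else b j) F (𝓝 x) := by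
      refine hx.congr' ?_
      filter_upwards [ha] with j hj
      simp [hj]
    exact this.mapClusterPt.mono hF

lemma IsCompact.exists_tendsto_ultrafilter {ι X : Type*} [TopologicalSpace X] {K : Set X}
    (hK : IsCompact K) {U : Ultrafilter ι} {a : ι → X} (ha : ∀ᶠ j in U, a j ∈ K) :
    ∃ x ∈ K, Tendsto a U (𝓝 x) :=
  hK.ultrafilter_le_nhds (U.map a) (le_principal_iff.2 ha)

/-! ### Limit sets -/

section LimitSet

variable {M X : Type*} [Group M] [MulAction M X] [TopologicalSpace X]

lemma isClosed_limitSet (Γ : Subgroup M) : IsClosed (limitSet X Γ) :=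
  (isOpen_sUnion fun _ hW => hW.1).isClosed_compl

lemma smul_mem_domainOfDiscontinuity {Γ : Subgroup M} {g : M} (hg : g ∈ Γ) {x : X}
    (hx : x ∈ domainOfDiscontinuity X Γ) : g • x ∈ domainOfDiscontinuity X Γ := by
  obtain ⟨W, hW, hxW⟩ := hx
  exact ⟨W, hW, by rw [← hW.2.1 g hg]; exact Set.smul_mem_smul_set hxW⟩

lemma smul_mem_limitSet {Γ : Subgroup M} {g : M} (hg : g ∈ Γ) {x : X}
    (hx : x ∈ limitSet X Γ) : g • x ∈ limitSet X Γ := fun h =>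
  hx (by simpa using smul_mem_domainOfDiscontinuity (Γ.inv_mem hg) h)

/-- Fixed points of elements of infinite order are limit points, already for the compact set
`{x}`. -/
lemma mem_limitSet_of_smul_eq {Γ : Subgroup M} {g : M} (hg : g ∈ Γ) (hfin : ¬ IsOfFinOrder g)
    {x : X} (hx : g • x = x) : x ∈ limitSet X Γ := by
  rintro ⟨W, hW, hxW⟩
  refine Set.infinite_of_injective_forall_mem (injective_pow_iff_not_isOfFinOrder.2 hfin)
    (fun n : ℕ => ?_) (hW.2.2 {x} isCompact_singleton (by simpa using hxW))
  have hn : g ^ n • x = x := by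
    induction n with
    | zero => simp
    | succ n ih => rw [pow_succ, mul_smul, hx, ih]
  exact ⟨Γ.pow_mem hg n, x, by simp [hn], rfl⟩

lemma inv_mul_mul_mem_of_mem_conj_smul {Γ : Subgroup M} {β γ : M} (hγ : γ ∈ MulAut.conj β • Γ) :
    β⁻¹ * γ * β ∈ Γ := by
  simpa [Subgroup.mem_pointwise_smul_iff_inv_smul_mem, ← map_inv] using hγ

lemma smul_mem_domainOfDiscontinuity_conj [ContinuousConstSMul M X] {Γ : Subgroup M} (β : M)
    {x : X} (hx : x ∈ domainOfDiscontinuity X Γ) :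
    β • x ∈ domainOfDiscontinuity X (MulAut.conj β • Γ) := by
  obtain ⟨W, ⟨hWo, hWinv, hWpd⟩, hxW⟩ := hx
  refine ⟨β • W, ⟨hWo.smul β, fun γ hγ => ?_, fun K hK hKW => ?_⟩, Set.smul_mem_smul_set hxW⟩
  · have := hWinv _ (inv_mul_mul_mem_of_mem_conj_smul hγ)
    rw [mul_assoc, mul_smul, inv_smul_eq_iff, mul_smul] at this
    exact this
  · have hfin := hWpd (β⁻¹ • K) (hK.smul β⁻¹) (by
      rwa [Set.smul_set_subset_iff_subset_inv_smul_set, inv_inv])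
    refine (hfin.image (fun γ => β * γ * β⁻¹)).subset ?_
    rintro γ ⟨hγ, hne⟩
    refine ⟨β⁻¹ * γ * β, ⟨inv_mul_mul_mem_of_mem_conj_smul hγ, ?_⟩, by group⟩
    rw [mul_assoc, mul_smul, mul_smul, smul_inv_smul, ← Set.smul_set_inter]
    exact hne.smul_set

lemma limitSet_conj [ContinuousConstSMul M X] (Γ : Subgroup M) (β : M) :
    limitSet X (MulAut.conj β • Γ) = β • limitSet X Γ := by
  ext x
  rw [Set.mem_smul_set_iff_inv_smul_mem]
  refine not_congr ⟨fun h => ?_, fun h => ?_⟩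
  · simpa [smul_smul, ← map_mul] using smul_mem_domainOfDiscontinuity_conj β⁻¹ h
  · simpa using smul_mem_domainOfDiscontinuity_conj β h

end LimitSet

/-! ### Conjugation by elements converging to the identity -/

/-- Maps `F (β j)` that depend jointly continuously on the parameter and the point, together with
left inverses, and that tend to the identity do not change the limit of a sequence of sets. -/
lemma SetsConverge.image_of_tendsto {X Y : Type*} [TopologicalSpace X] [TopologicalSpace Y]
    {As : ℕ → Set X} {A : Set X} (h : SetsConverge As A) (F F' : Y → X → X)
    (hF : Continuous fun p : Y × X => F p.1 p.2) (hF' : Continuous fun p : Y × X => F' p.1 p.2)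
    {β : ℕ → Y} {y : Y} (hβ : Tendsto β atTop (𝓝 y)) (hy : F y = id) (hy' : F' y = id)
    (hinv : ∀ j x, F' (β j) (F (β j) x) = x) :
    SetsConverge (fun j => F (β j) '' As j) A := by
  refine ⟨fun x hx => ?_, fun a ha x hx => ?_⟩
  · obtain ⟨a, ha, hax⟩ := h.1 x hx
    refine ⟨fun j => F (β j) (a j), fun j => ⟨a j, ha j, rfl⟩, ?_⟩
    simpa [hy, Function.comp_def] using (hF.tendsto (y, x)).comp (hβ.prodMk_nhds hax)
  · choose b hb hba using ha
    obtain ⟨U, hU, hUx⟩ := mapClusterPt_iff_ultrafilter.1 hx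
    have hb' : Tendsto b U (𝓝 x) := by
      have := (hF'.tendsto (y, x)).comp ((hβ.mono_left hU).prodMk_nhds hUx)
      simp only [hy', id] at this
      refine this.congr fun j => ?_
      simp [← hba j, hinv]
    exact h.2 b hb x (hb'.mapClusterPt.mono hU)

/-! ### Geometric limits of discrete torsion-free groups -/

section Geometric

variable {M : Type*} [Group M] [TopologicalSpace M] [IsTopologicalGroup M] [T2Space M]

lemma exists_pow_notMem_of_isCompact (Γ : Subgroup M) [DiscreteTopology Γ] {K : Set M}
    (hK : IsCompact K) {g : M} (hg : g ∈ Γ) (hfin : ¬ IsOfFinOrder g) : ∃ n : ℕ, g ^ n ∉ K := by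
  by_contra! hmem
  have hfinite : {x : Γ | (x : M) ∈ K}.Finite := by
    have := Γ.tendsto_coe_cofinite_of_discrete (by exact ⟨‹_›⟩) hK.compl_mem_cocompact
    simpa [Filter.mem_cofinite, Set.preimage, Set.compl_ofPred] using this
  refine Set.infinite_of_injective_forall_mem (f := fun n : ℕ => (⟨g ^ n, Γ.pow_mem hg n⟩ : Γ))
    (fun m n hmn => ?_) hmem hfinite
  exact injective_pow_iff_not_isOfFinOrder.2 hfin (congrArg Subtype.val hmn)

/-- Discrete torsion-free groups converging to a discrete group `Γ` have no small elements. Take a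
compact neighbourhood `K` of `1` with `K ∩ Γ = {1}`. The powers of a nontrivial element of `Γs j`
leave `K`; as `j` grows, the last powers before that tend to an element of `K ∩ Γ`, that is, to `1`.
If the elements tend to `1`, then so do the next powers, although they are outside `K`. -/
lemma eventually_eq_one_of_tendsto_one [LocallyCompactSpace M] {Γs : ℕ → Subgroup M}
    {Γ : Subgroup M} [DiscreteTopology Γ] (hd : ∀ j, DiscreteTopology (Γs j))
    (htf : ∀ j, ∀ g ∈ Γs j, IsOfFinOrder g → g = 1)
    (hconv : SetsConverge (fun j => (Γs j : Set M)) (Γ : Set M)) {U : Ultrafilter ℕ}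
    (hU : (U : Filter ℕ) ≤ atTop) {g : ℕ → M} (hg : ∀ j, g j ∈ Γs j)
    (hlim : Tendsto g U (𝓝 1)) : ∀ᶠ j in U, g j = 1 := by
  obtain ⟨V, hVo, hV⟩ : ∃ V : Set M, IsOpen V ∧ V ∩ Γ = {1} := by
    obtain ⟨V, hVo, hV⟩ := isOpen_induced_iff.1 (isOpen_discrete ({1} : Set Γ))
    refine ⟨V, hVo, Set.ext fun x => ⟨fun hx => ?_, ?_⟩⟩
    · have : (⟨x, hx.2⟩ : Γ) ∈ ({1} : Set Γ) := by rw [← hV]; exact hx.1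
      exact congrArg Subtype.val this
    · rintro rfl
      exact ⟨show (1 : Γ) ∈ Subtype.val ⁻¹' V by rw [hV]; rfl, Γ.one_mem⟩
  have h1V : (1 : M) ∈ V := (hV.symm ▸ rfl : (1 : M) ∈ V ∩ Γ).1
  obtain ⟨K, hK1, hKV, hK⟩ := local_compact_nhds (hVo.mem_nhds h1V)
  by_contra hne
  rw [Ultrafilter.eventually_not.symm] at hne
  -- The first power of `g j` outside the compact neighbourhood `K` of `1`.
  have hexit : ∀ j, ∃ k : ℕ, g j ≠ 1 → g j ^ k ∈ K ∧ g j ^ (k + 1) ∉ K := by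
    intro j
    by_cases hj : g j = 1
    · exact ⟨0, fun h => absurd hj h⟩
    have := hd j
    have hex := exists_pow_notMem_of_isCompact (Γs j) hK (hg j) fun h => hj (htf j _ (hg j) h)
    classical
    obtain ⟨k, hk⟩ : ∃ k, Nat.find hex = k + 1 := by
      refine Nat.exists_eq_succ_of_ne_zero fun h0 => Nat.find_spec hex ?_
      rw [h0, pow_zero]
      exact mem_of_mem_nhds hK1
    refine ⟨k, fun _ => ⟨?_, hk ▸ Nat.find_spec hex⟩⟩
    exact not_not.1 (Nat.find_min hex (m := k) (by omega))
  choose k hk using hexit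
  obtain ⟨x, hxK, hx⟩ := hK.exists_tendsto_ultrafilter (hne.mono fun j hj => (hk j hj).1)
  have hxΓ : x ∈ Γ := hconv.mem_of_tendsto (fun j => ⟨1, (Γs j).one_mem⟩) hU
    (.of_forall fun j => (Γs j).pow_mem (hg j) (k j)) hx
  obtain rfl : x = 1 := hV.subset ⟨hKV hxK, hxΓ⟩
  have hx' : Tendsto (fun j => g j ^ (k j + 1)) U (𝓝 1) := by
    simpa [pow_succ] using hx.mul hlim
  obtain ⟨j, hj, hj'⟩ := ((hx'.eventually_mem hK1).and hne).exists
  exact (hk j hj').2 hj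

end Geometric

/-! ### Invariant Jordan curves through the fixed point -/

/-- A circle minus a point is a line, by stereographic projection. -/
lemma exists_isEmbedding_real_circle (t : Circle) :
    ∃ e : ℝ → Circle, IsEmbedding e ∧ Set.range e = {t}ᶜ := by
  let t' : Metric.sphere (0 : ℂ) 1 := ⟨t, by simp [t.norm_coe]⟩
  have ht : ‖(t' : ℂ)‖ = 1 := t.norm_coe
  have hne : (t' : ℂ) ≠ 0 := norm_ne_zero_iff.1 (by rw [ht]; exact one_ne_zero)
  have : Fact (Module.finrank ℝ ℂ = 1 + 1) := ⟨by simp [Complex.finrank_real_complex]⟩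
  have hrank : Module.finrank ℝ ℝ = Module.finrank ℝ (Submodule.span ℝ {(t' : ℂ)})ᗮ := by
    rw [Submodule.finrank_orthogonal_span_singleton (n := 1) hne, Module.finrank_self]
  let L : ℝ ≃L[ℝ] (Submodule.span ℝ {(t' : ℂ)})ᗮ :=
    (FiniteDimensional.nonempty_continuousLinearEquiv_of_finrank_eq hrank).some
  let s : Metric.sphere (0 : ℂ) 1 ≃ₜ Circle :=
    { toFun := fun z => ⟨z, by simp [Submonoid.unitSphere]⟩
      invFun := fun z => ⟨z, by simp [z.norm_coe]⟩
      left_inv := fun _ => rfl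
      right_inv := fun _ => rfl
      continuous_toFun := continuous_induced_rng.2 continuous_subtype_val
      continuous_invFun := continuous_induced_rng.2 continuous_subtype_val }
  refine ⟨s ∘ (stereographic ht).symm ∘ L, s.isEmbedding.comp
    ((isOpenEmbedding_stereographic_symm ht).isEmbedding.comp L.toHomeomorph.isEmbedding), ?_⟩
  rw [Set.range_comp, L.surjective.range_comp, range_stereographic_symm,
    Set.image_compl_eq s.bijective]
  simp only [Set.image_singleton]
  rfl

/-- A fixed-point-free homeomorphism of the line has a compact set meeting every orbit. -/
lemma exists_isCompact_iterate_mem {ψ φ : ℝ → ℝ} (hψ : Continuous ψ) (hφ : Continuous φ)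
    (hψφ : Function.LeftInverse ψ φ) (hφψ : Function.LeftInverse φ ψ) (hfix : ∀ t, ψ t ≠ t) :
    ∃ K : Set ℝ, IsCompact K ∧ ∀ t, (∃ n : ℕ, ψ^[n] t ∈ K) ∨ ∃ n : ℕ, φ^[n] t ∈ K := by
  -- By the intermediate value theorem one of `ψ` and its inverse `φ` moves all points upwards.
  wlog hlt : ∀ t, t < ψ t generalizing ψ φ
  · have hgt : ∀ t, ψ t < t := by
      by_contra! hcon
      push Not at hlt
      obtain ⟨a, ha⟩ := hlt
      obtain ⟨b, hb⟩ := hcon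
      obtain ⟨t, ht⟩ := mem_range_of_exists_le_of_exists_ge (c := 0) (f := fun t => ψ t - t)
        (hψ.sub continuous_id) ⟨a, by simpa using ha⟩ ⟨b, by simpa using hb⟩
      exact hfix t (by simpa [sub_eq_zero] using ht)
    obtain ⟨K, hK, h⟩ := this hφ hψ hφψ hψφ (fun t ht => hfix (φ t) (by rw [hψφ t, ht]))
      (fun t => by simpa [hψφ t] using hgt (φ t))
    exact ⟨K, hK, fun t => (h t).symm⟩
  have hmono : StrictMono ψ := by
    refine (hψ.strictMono_of_inj hφψ.injective).resolve_right fun h => ?_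
    exact (h (hlt 0)).not_gt (hlt (ψ 0))
  -- A bounded forward orbit would increase to a fixed point.
  have hunb : ∀ a t, ∃ n : ℕ, a ≤ ψ^[n] t := by
    intro a t
    by_contra! hcon
    have hm : Monotone fun n => ψ^[n] t := monotone_nat_of_le_succ fun n => by
      rw [Function.iterate_succ_apply']
      exact (hlt _).le
    have hl := tendsto_atTop_ciSup hm ⟨a, by rintro _ ⟨n, rfl⟩; exact (hcon n).le⟩
    exact hfix _ (isFixedPt_of_tendsto_iterate hl hψ.continuousAt)
  refine ⟨Set.Icc 0 (ψ 0), isCompact_Icc, fun t => ?_⟩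
  classical
  -- The first nonnegative point of an orbit is in `[0, ψ 0]`.
  rcases lt_or_ge t 0 with ht | ht
  · left
    obtain ⟨n, hn⟩ : ∃ n, Nat.find (hunb 0 t) = n + 1 := by
      refine Nat.exists_eq_succ_of_ne_zero fun h0 => ?_
      have := Nat.find_spec (hunb 0 t)
      rw [h0] at this
      exact this.not_gt ht
    have h1 := Nat.find_spec (hunb 0 t)
    rw [hn] at h1
    have h2 := Nat.find_min (hunb 0 t) (m := n) (by omega)
    refine ⟨n + 1, h1, ?_⟩
    rw [Function.iterate_succ_apply']
    exact (hmono (not_le.1 h2)).le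
  · right
    have hex : ∃ n : ℕ, t ≤ ψ^[n + 1] 0 := by
      obtain ⟨n, hn⟩ := hunb t (ψ 0)
      exact ⟨n, hn⟩
    have h1 := Nat.find_spec hex
    have hinv : ψ^[Nat.find hex] (φ^[Nat.find hex] t) = t := hψφ.iterate _ t
    refine ⟨Nat.find hex, ?_, ?_⟩
    · rw [← (hmono.iterate (Nat.find hex)).le_iff_le, hinv]
      rcases h : Nat.find hex with _ | n
      · simpa using ht
      · exact (not_le.1 (Nat.find_min hex (m := n) (by omega))).le
    · rw [← (hmono.iterate (Nat.find hex)).le_iff_le, hinv]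
      exact h1

lemma exists_isCompact_zpow_smul_mem {M X : Type*} [Group M] [MulAction M X] [TopologicalSpace X]
    [ContinuousConstSMul M X] {e : ℝ → X} (he : IsEmbedding e) {γ : M}
    (hγ : γ • Set.range e = Set.range e) (hfix : ∀ t, γ • e t ≠ e t) :
    ∃ K ⊆ Set.range e, IsCompact K ∧ ∀ x ∈ Set.range e, ∃ n : ℤ, γ ^ n • x ∈ K := by
  have hγ' : γ⁻¹ • Set.range e = Set.range e := by rw [inv_smul_eq_iff, hγ]
  have h1 : ∀ t, ∃ s, e s = γ • e t := fun t =>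
    hγ.subset (Set.smul_mem_smul_set (Set.mem_range_self t))
  have h2 : ∀ t, ∃ s, e s = γ⁻¹ • e t := fun t =>
    hγ'.subset (Set.smul_mem_smul_set (Set.mem_range_self t))
  choose ψ hψ using h1
  choose φ hφ using h2
  have hψc : Continuous ψ := by
    rw [he.continuous_iff, show e ∘ ψ = fun t => γ • e t from funext hψ]
    exact he.continuous.const_smul γ
  have hφc : Continuous φ := by
    rw [he.continuous_iff, show e ∘ φ = fun t => γ⁻¹ • e t from funext hφ]
    exact he.continuous.const_smul γ⁻¹
  obtain ⟨K, hK, h⟩ := exists_isCompact_iterate_mem hψc hφc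
    (fun t => he.injective (by rw [hψ, hφ, smul_inv_smul]))
    (fun t => he.injective (by rw [hφ, hψ, inv_smul_smul]))
    (fun t ht => hfix t (by rw [← hψ, ht]))
  refine ⟨e '' K, Set.image_subset_range _ _, hK.image he.continuous, ?_⟩
  rintro _ ⟨t, rfl⟩
  have hψn : ∀ n : ℕ, e (ψ^[n] t) = γ ^ n • e t := fun n => by
    induction n with
    | zero => simp
    | succ n ih => rw [Function.iterate_succ_apply', hψ, ih, pow_succ', mul_smul]
  have hφn : ∀ n : ℕ, e (φ^[n] t) = γ⁻¹ ^ n • e t := fun n => by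
    induction n with
    | zero => simp
    | succ n ih => rw [Function.iterate_succ_apply', hφ, ih, pow_succ', mul_smul]
  rcases h t with ⟨n, hn⟩ | ⟨n, hn⟩
  · exact ⟨n, _, hn, by simp [hψn]⟩
  · exact ⟨-n, _, hn, by simp [hφn]⟩

/-! ### Fixed points of Möbius transformations -/

lemma IsParabolicMoebius.exists_fixedBy_eq_singleton {γ : PSL(2, ℂ)} (hγ : IsParabolicMoebius γ) :
    ∃ p, MulAction.fixedBy (OnePoint ℂ) γ = {p} := by
  obtain ⟨g, rfl, hg⟩ := hγ
  have hg' : (g : GL (Fin 2) ℂ).IsParabolic := hg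
  refine ⟨(g : GL (Fin 2) ℂ).parabolicFixedPoint, Set.ext fun x => ?_⟩
  rw [MulAction.mem_fixedBy, moebiusAction_mk_smul, hg'.smul_eq_self_iff, Set.mem_singleton_iff]

lemma exists_smul_infty_eq (p : OnePoint ℂ) :
    ∃ k : PSL(2, ℂ), k • (OnePoint.infty : OnePoint ℂ) = p := by
  have h : (OnePoint.infty : OnePoint ℂ) = ofHomogeneous ![1, 0] := by simp [ofHomogeneous]
  induction p using OnePoint.rec with
  | infty => exact ⟨1, one_smul _ _⟩
  | coe z =>
    let A : SL(2, ℂ) := ⟨!![z, -1; 1, 0], by simp [Matrix.det_fin_two]⟩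
    refine ⟨QuotientGroup.mk A, ?_⟩
    rw [h]
    refine (mk_smul_ofHomogeneous A (by simp)).trans ?_
    simp [ofHomogeneous, A]

/-- If the limit set of a torsion-free group is a single point, then this is the only fixed point
of every nontrivial element, so that after a conjugation the group consists of translations. -/
lemma exists_mem_limitSet_ne {Γ : Subgroup PSL(2, ℂ)} (htf : ∀ g ∈ Γ, IsOfFinOrder g → g = 1)
    (hna : ¬ ∀ a ∈ Γ, ∀ b ∈ Γ, a * b = b * a) {p : OnePoint ℂ}
    (hp : p ∈ limitSet (OnePoint ℂ) Γ) : ∃ x ∈ limitSet (OnePoint ℂ) Γ, x ≠ p := by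
  by_contra! hall
  obtain ⟨k, rfl⟩ := exists_smul_infty_eq p
  have hform : ∀ g ∈ Γ, ∃ A : SL(2, ℂ), (QuotientGroup.mk A : PSL(2, ℂ)) = k⁻¹ * g * k ∧
      A 1 0 = 0 ∧ A 0 0 = A 1 1 := by
    intro g hg
    by_cases hg1 : g = 1
    · exact ⟨1, by simp [hg1], by simp, by simp⟩
    obtain ⟨A, hA⟩ := QuotientGroup.mk_surjective (k⁻¹ * g * k)
    have hfix : ∀ z : OnePoint ℂ, (A : GL (Fin 2) ℂ) • z = z ↔ z = OnePoint.infty := by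
      intro z
      have hz : (A : GL (Fin 2) ℂ) • z = z ↔ g • k • z = k • z := by
        rw [← moebiusAction_mk_smul]
        erw [hA]
        rw [mul_smul, mul_smul, inv_smul_eq_iff]
      rw [hz]
      constructor
      · intro h
        exact MulAction.injective k (hall _ (mem_limitSet_of_smul_eq hg
          (fun h => hg1 (htf g hg h)) h))
      · rintro rfl
        exact hall _ (smul_mem_limitSet hg hp)
    have h10 : A 1 0 = 0 := OnePoint.smul_infty_eq_self_iff.1 ((hfix _).2 rfl)
    refine ⟨A, hA, h10, ?_⟩
    -- Otherwise `A` has a second fixed point, namely `b / (d - a)` for the entries `a, b, d`.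
    by_contra hne
    have hdet : A 0 0 * A 1 1 = 1 := by
      have := A.det_coe
      rwa [Matrix.det_fin_two, h10, mul_zero, sub_zero] at this
    have h11 : A 1 1 ≠ 0 := right_ne_zero_of_mul_eq_one hdet
    have hsub : A 1 1 - A 0 0 ≠ 0 := sub_ne_zero.2 (Ne.symm hne)
    have := (hfix ((A 0 1 / (A 1 1 - A 0 0) : ℂ) : OnePoint ℂ)).1 (by
      have h10' : (A : GL (Fin 2) ℂ) 1 0 = 0 := h10
      have h11' : (A : GL (Fin 2) ℂ) 1 1 ≠ 0 := h11
      rw [OnePoint.smul_some_eq_ite, h10', zero_mul, zero_add, if_neg h11']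
      congr 1
      change (A 0 0 * (A 0 1 / (A 1 1 - A 0 0)) + A 0 1) / A 1 1 = A 0 1 / (A 1 1 - A 0 0)
      field_simp
      ring)
    exact OnePoint.coe_ne_infty _ this
  refine hna fun a ha b hb => ?_
  obtain ⟨A, hA, hA1, hA2⟩ := hform a ha
  obtain ⟨B, hB, hB1, hB2⟩ := hform b hb
  have hAB : A * B = B * A := by
    ext i j
    fin_cases i <;> fin_cases j <;> simp [Matrix.mul_apply, Fin.sum_univ_two, hA1, hB1, hA2, hB2] <;>
      ring
  have : k⁻¹ * (a * b) * k = k⁻¹ * (b * a) * k := by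
    calc k⁻¹ * (a * b) * k = (k⁻¹ * a * k) * (k⁻¹ * b * k) := by group
      _ = (k⁻¹ * b * k) * (k⁻¹ * a * k) := by
        rw [← hA, ← hB]
        exact congrArg QuotientGroup.mk hAB
      _ = k⁻¹ * (b * a) * k := by group
  simpa using this

/-! ### Divergent sequences of Möbius transformations -/

lemma ofHomogeneous_mulVec_eq_of_det_eq_zero {N : Matrix (Fin 2) (Fin 2) ℂ} (hN : N.det = 0)
    {v w : Fin 2 → ℂ} (hv : N *ᵥ v ≠ 0) (hw : N *ᵥ w ≠ 0) :
    ofHomogeneous (N *ᵥ v) = ofHomogeneous (N *ᵥ w) := by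
  rw [ofHomogeneous_eq_iff hv hw]
  rw [Matrix.det_fin_two] at hN
  simp only [Matrix.mulVec_fin_two, Matrix.cons_val_zero, Matrix.cons_val_one]
  linear_combination (v 0 * w 1 - v 1 * w 0) * hN

lemma ofHomogeneous_eq_of_mulVec_eq_zero {N : Matrix (Fin 2) (Fin 2) ℂ} (hN : N ≠ 0)
    {v w : Fin 2 → ℂ} (hv : v ≠ 0) (hw : w ≠ 0) (hNv : N *ᵥ v = 0) (hNw : N *ᵥ w = 0) :
    ofHomogeneous v = ofHomogeneous w := by
  rw [ofHomogeneous_eq_iff hv hw]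
  by_contra hne
  have hne' := sub_ne_zero.2 hne
  refine hN (Matrix.ext fun i j => ?_)
  have h1 : N i 0 * v 0 + N i 1 * v 1 = 0 := by
    simpa [Matrix.mulVec, dotProduct, Fin.sum_univ_two] using congrFun hNv i
  have h2 : N i 0 * w 0 + N i 1 * w 1 = 0 := by
    simpa [Matrix.mulVec, dotProduct, Fin.sum_univ_two] using congrFun hNw i
  fin_cases j
  · exact (mul_eq_zero.1 (show (v 0 * w 1 - w 0 * v 1) * N i 0 = 0 by
      linear_combination w 1 * h1 - v 1 * h2)).resolve_left hne'
  · exact (mul_eq_zero.1 (show (v 0 * w 1 - w 0 * v 1) * N i 1 = 0 by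
      linear_combination v 0 * h2 - w 0 * h1)).resolve_left hne'

/-- A convergent sequence on the sphere lifts to a convergent sequence of homogeneous coordinates
along an ultrafilter, by compactness of the unit sphere in `ℂ²`. -/
lemma exists_tendsto_lift {U : Ultrafilter ℕ} {x : ℕ → OnePoint ℂ} {x₀ : OnePoint ℂ}
    (hx : Tendsto x U (𝓝 x₀)) : ∃ (v : ℕ → Fin 2 → ℂ) (v₀ : Fin 2 → ℂ), (∀ j, v j ≠ 0) ∧
      (∀ j, ofHomogeneous (v j) = x j) ∧ v₀ ≠ 0 ∧ ofHomogeneous v₀ = x₀ ∧ Tendsto v U (𝓝 v₀) := by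
  choose v hv hvx using fun j => exists_norm_eq_one_ofHomogeneous_eq (x j)
  obtain ⟨v₀, hv₀, hlim⟩ := (isCompact_sphere (0 : Fin 2 → ℂ) 1).exists_tendsto_ultrafilter
    (.of_forall fun j => mem_sphere_zero_iff_norm.2 (hv j))
  have hne : v₀ ≠ 0 := ne_zero_of_mem_unit_sphere ⟨v₀, hv₀⟩
  refine ⟨v, v₀, fun j => ne_zero_of_mem_unit_sphere ⟨v j, by simpa using hv j⟩, hvx, hne, ?_, hlim⟩
  refine tendsto_nhds_unique ((continuousAt_ofHomogeneous hne).tendsto.comp hlim) ?_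
  simpa [Function.comp_def, hvx] using hx

lemma tendsto_mk_smul_ofHomogeneous {F : Filter ℕ} {A : ℕ → SL(2, ℂ)} {c : ℕ → ℂ}
    (hc : ∀ j, c j ≠ 0) {N : Matrix (Fin 2) (Fin 2) ℂ}
    (hN : Tendsto (fun j => c j • (A j : Matrix (Fin 2) (Fin 2) ℂ)) F (𝓝 N))
    {v : ℕ → Fin 2 → ℂ} {v₀ : Fin 2 → ℂ} (hv : ∀ j, v j ≠ 0) (hlim : Tendsto v F (𝓝 v₀))
    (hNv : N *ᵥ v₀ ≠ 0) :
    Tendsto (fun j => (QuotientGroup.mk (A j) : PSL(2, ℂ)) • ofHomogeneous (v j)) F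
      (𝓝 (ofHomogeneous (N *ᵥ v₀))) := by
  have hcont : Continuous fun p : Matrix (Fin 2) (Fin 2) ℂ × (Fin 2 → ℂ) => p.1 *ᵥ p.2 :=
    continuous_fst.matrix_mulVec continuous_snd
  have h1 := (continuousAt_ofHomogeneous hNv).tendsto.comp
    ((hcont.tendsto (N, v₀)).comp (hN.prodMk_nhds hlim))
  refine h1.congr fun j => ?_
  calc ofHomogeneous ((c j • (A j : Matrix (Fin 2) (Fin 2) ℂ)) *ᵥ v j)
      = ofHomogeneous (c j • (A j : Matrix (Fin 2) (Fin 2) ℂ) *ᵥ v j) := by rw [Matrix.smul_mulVec]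
    _ = ofHomogeneous ((A j : Matrix (Fin 2) (Fin 2) ℂ) *ᵥ v j) := ofHomogeneous_smul (hc j) _
    _ = _ := (mk_smul_ofHomogeneous _ (hv j)).symm

/-- The common limit of all but one point under a divergent sequence lies in the limit set. -/
lemma exists_ofHomogeneous_mulVec_mem_limitSet {Γs : ℕ → Subgroup PSL(2, ℂ)} {Λ : Set (OnePoint ℂ)}
    (hlim : SetsConverge (fun j => limitSet (OnePoint ℂ) (Γs j)) Λ)
    {z₁ z₂ : OnePoint ℂ} (hz₁ : z₁ ∈ Λ) (hz₂ : z₂ ∈ Λ) (hz : z₁ ≠ z₂)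
    {U : Ultrafilter ℕ} (hU : (U : Filter ℕ) ≤ atTop) {A : ℕ → SL(2, ℂ)}
    (hA : ∀ j, (QuotientGroup.mk (A j) : PSL(2, ℂ)) ∈ Γs j) {c : ℕ → ℂ} (hc : ∀ j, c j ≠ 0)
    {N : Matrix (Fin 2) (Fin 2) ℂ} (hN0 : N ≠ 0)
    (hN : Tendsto (fun j => c j • (A j : Matrix (Fin 2) (Fin 2) ℂ)) U (𝓝 N)) :
    ∃ w, N *ᵥ w ≠ 0 ∧ ofHomogeneous (N *ᵥ w) ∈ Λ := by
  have key : ∀ z ∈ Λ, ∃ w, w ≠ 0 ∧ ofHomogeneous w = z ∧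
      (N *ᵥ w ≠ 0 → ofHomogeneous (N *ᵥ w) ∈ Λ) := by
    intro z hz
    obtain ⟨a, ha, haz⟩ := hlim.1 z hz
    obtain ⟨w, w₀, hw, hwa, hw₀, hwz, hlimw⟩ := exists_tendsto_lift (haz.mono_left hU)
    refine ⟨w₀, hw₀, hwz, fun hNw => ?_⟩
    refine hlim.mem_of_tendsto (fun j => ⟨a j, ha j⟩) hU (.of_forall fun j => ?_)
      (tendsto_mk_smul_ofHomogeneous hc hN hw hlimw hNw)
    exact smul_mem_limitSet (hA j) (by rw [hwa]; exact ha j)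
  obtain ⟨w₁, hw₁, hwz₁, h₁⟩ := key z₁ hz₁
  obtain ⟨w₂, hw₂, hwz₂, h₂⟩ := key z₂ hz₂
  by_cases hN₁ : N *ᵥ w₁ = 0
  · refine ⟨w₂, fun hN₂ => hz ?_, h₂ fun hN₂ => hz ?_⟩ <;>
      rw [← hwz₁, ← hwz₂, ofHomogeneous_eq_of_mulVec_eq_zero hN0 hw₁ hw₂ hN₁ hN₂]
  · exact ⟨w₁, hN₁, h₁ hN₁⟩

open scoped Matrix.Norms.Elementwise in
/-- The convergence property: if elements of the groups `Γs j` carry points `x j` to points `y j`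
and the limits of both sequences are outside the limit of the limit sets, then the elements cannot
diverge. -/
lemma not_tendsto_norm_atTop {Γs : ℕ → Subgroup PSL(2, ℂ)} {Λ : Set (OnePoint ℂ)}
    (hlim : SetsConverge (fun j => limitSet (OnePoint ℂ) (Γs j)) Λ) (hΛ : Λ.Nontrivial)
    {U : Ultrafilter ℕ} (hU : (U : Filter ℕ) ≤ atTop) {A : ℕ → SL(2, ℂ)}
    (hA : ∀ j, (QuotientGroup.mk (A j) : PSL(2, ℂ)) ∈ Γs j) {x : ℕ → OnePoint ℂ}
    {x₀ y₀ : OnePoint ℂ} (hx : Tendsto x U (𝓝 x₀))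
    (hy : Tendsto (fun j => (QuotientGroup.mk (A j) : PSL(2, ℂ)) • x j) U (𝓝 y₀))
    (hx₀ : x₀ ∉ Λ) (hy₀ : y₀ ∉ Λ) :
    ¬ Tendsto (fun j => ‖(A j : Matrix (Fin 2) (Fin 2) ℂ)‖) U atTop := by
  intro hdiv
  obtain ⟨z₁, hz₁, z₂, hz₂, hz⟩ := hΛ
  have hA0 : ∀ j, (A j : Matrix (Fin 2) (Fin 2) ℂ) ≠ 0 := fun j h => by
    have := (A j).det_coe
    simp [h] at this
  -- Rescaled to norm one, the matrices converge to a matrix `N` of rank one.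
  let c : ℕ → ℂ := fun j => ((‖(A j : Matrix (Fin 2) (Fin 2) ℂ)‖⁻¹ : ℝ) : ℂ)
  have hc : ∀ j, c j ≠ 0 := fun j => by simpa [c] using hA0 j
  have : ProperSpace (Matrix (Fin 2) (Fin 2) ℂ) := FiniteDimensional.proper_rclike ℂ _
  obtain ⟨N, hN1, hN⟩ := (isCompact_sphere (0 : Matrix (Fin 2) (Fin 2) ℂ) 1).exists_tendsto_ultrafilter
    (U := U) (a := fun j => c j • (A j : Matrix (Fin 2) (Fin 2) ℂ)) (.of_forall fun j => by
      rw [mem_sphere_zero_iff_norm, norm_smul, Complex.norm_real, norm_inv, norm_norm,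
        inv_mul_cancel₀ (norm_ne_zero_iff.2 (hA0 j))])
  have hN0 : N ≠ 0 := ne_zero_of_mem_unit_sphere ⟨N, hN1⟩
  have hdet : N.det = 0 := by
    have h1 := ((continuous_id.matrix_det).tendsto N).comp hN
    refine tendsto_nhds_unique h1 ?_
    have h2 : Tendsto c U (𝓝 0) := by
      have := (Complex.continuous_ofReal.tendsto 0).comp (tendsto_inv_atTop_zero.comp hdiv)
      simpa [c, Function.comp_def] using this
    have h3 : Tendsto (fun j => c j ^ 2) U (𝓝 0) := by simpa using h2.pow 2
    refine h3.congr fun j => ?_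
    simp
  obtain ⟨v, v₀, hv, hvx, hv₀, hvx₀, hvlim⟩ := exists_tendsto_lift hx
  by_cases hNv : N *ᵥ v₀ = 0
  · -- The point `x₀` is the kernel of `N`, which is the image of the adjugate of `N`.
    have hadj : Tendsto (fun j => c j • ((A j)⁻¹ : SL(2, ℂ)).1) U (𝓝 N.adjugate) := by
      refine ((continuous_id.matrix_adjugate.tendsto N).comp hN).congr fun j => ?_
      simp [Matrix.adjugate_smul, Matrix.SpecialLinearGroup.coe_inv]
    have hadj0 : N.adjugate ≠ 0 := fun h => hN0 <| by
      rw [Matrix.adjugate_fin_two] at h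
      ext i j
      have h00 := congrFun (congrFun h 0) 0
      have h01 := congrFun (congrFun h 0) 1
      have h10 := congrFun (congrFun h 1) 0
      have h11 := congrFun (congrFun h 1) 1
      fin_cases i <;> fin_cases j <;> simp_all
    obtain ⟨w, hw, hwΛ⟩ := exists_ofHomogeneous_mulVec_mem_limitSet hlim hz₁ hz₂ hz hU
      (fun j => (Γs j).inv_mem (hA j)) hc hadj0 hadj
    have hker : N *ᵥ (N.adjugate *ᵥ w) = 0 := by
      rw [Matrix.mulVec_mulVec, Matrix.mul_adjugate, hdet, zero_smul, Matrix.zero_mulVec]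
    rw [← ofHomogeneous_eq_of_mulVec_eq_zero hN0 hv₀ hw hNv hker, hvx₀] at hwΛ
    exact hx₀ hwΛ
  · obtain ⟨w, hw, hwΛ⟩ := exists_ofHomogeneous_mulVec_mem_limitSet hlim hz₁ hz₂ hz hU hA hc hN0 hN
    have h := tendsto_mk_smul_ofHomogeneous hc hN hv hvlim hNv
    simp only [hvx] at h
    rw [tendsto_nhds_unique hy h, ofHomogeneous_mulVec_eq_of_det_eq_zero hdet hNv hw] at hy₀
    exact hy₀ hwΛ

open scoped Matrix.Norms.Elementwise in
lemma exists_tendsto_mk_of_not_tendsto_norm {U : Ultrafilter ℕ} {A : ℕ → SL(2, ℂ)}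
    (h : ¬ Tendsto (fun j => ‖(A j : Matrix (Fin 2) (Fin 2) ℂ)‖) U atTop) :
    ∃ g : PSL(2, ℂ), Tendsto (fun j => (QuotientGroup.mk (A j) : PSL(2, ℂ))) U (𝓝 g) := by
  rw [tendsto_atTop] at h
  push Not at h
  obtain ⟨R, hR⟩ := h
  have : ProperSpace (Matrix (Fin 2) (Fin 2) ℂ) := FiniteDimensional.proper_rclike ℂ _
  have hK := Matrix.SpecialLinearGroup.isClosedEmbedding_val.isCompact_preimage
    (isCompact_closedBall (0 : Matrix (Fin 2) (Fin 2) ℂ) R)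
  obtain ⟨B, -, hB⟩ := hK.exists_tendsto_ultrafilter
    (hR.mono fun j hj => mem_closedBall_zero_iff.2 hj.le)
  exact ⟨QuotientGroup.mk B, (continuous_quot_mk.tendsto B).comp hB⟩

/-! ### Precise invariance in approximating groups -/

lemma exists_ultrafilter_of_frequently {P : ℕ → Prop} (h : ∃ᶠ j in atTop, P j) :
    ∃ U : Ultrafilter ℕ, (U : Filter ℕ) ≤ atTop ∧ ∀ᶠ j in U, P j := by
  have : NeBot (atTop ⊓ 𝓟 {j | P j}) := frequently_mem_iff_neBot.1 h
  exact ⟨Ultrafilter.of _, (Ultrafilter.of_le _).trans inf_le_left,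
    (Ultrafilter.of_le _).trans inf_le_right (mem_principal_self _)⟩

lemma eventually_subset_domainOfDiscontinuity {Γs : ℕ → Subgroup PSL(2, ℂ)} {Λ : Set (OnePoint ℂ)}
    (hlim : SetsConverge (fun j => limitSet (OnePoint ℂ) (Γs j)) Λ) (hΛ : Λ.Nonempty)
    {K : Set (OnePoint ℂ)} (hK : IsCompact K) (hKΛ : Disjoint K Λ) :
    ∀ᶠ j in atTop, K ⊆ domainOfDiscontinuity (OnePoint ℂ) (Γs j) := by
  by_contra hcon
  obtain ⟨U, hU, hbad⟩ := exists_ultrafilter_of_frequently (not_eventually.1 hcon)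
  obtain ⟨z, hz⟩ := hΛ
  obtain ⟨a, ha, -⟩ := hlim.1 z hz
  have hex : ∀ j, ∃ x, x ∈ limitSet (OnePoint ℂ) (Γs j) ∧
      (¬ K ⊆ domainOfDiscontinuity (OnePoint ℂ) (Γs j) → x ∈ K) := by
    intro j
    by_cases hj : K ⊆ domainOfDiscontinuity (OnePoint ℂ) (Γs j)
    · exact ⟨a j, ha j, fun h => absurd hj h⟩
    · obtain ⟨x, hxK, hx⟩ := Set.not_subset.1 hj
      exact ⟨x, hx, fun _ => hxK⟩
  choose x hx hxK using hex
  obtain ⟨x₀, hx₀, hxlim⟩ := hK.exists_tendsto_ultrafilter (hbad.mono hxK)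
  exact hKΛ.le_bot ⟨hx₀, hlim.mem_of_tendsto (fun j => ⟨a j, ha j⟩) hU (.of_forall hx) hxlim⟩

open scoped Matrix.Norms.Elementwise in
/-- Precise invariance of a set with compact quotient by `γ` passes from the limit group to the
approximating groups. -/
theorem eventually_isPreciselyInvariant {Γs : ℕ → Subgroup PSL(2, ℂ)} {Γ : Subgroup PSL(2, ℂ)}
    [DiscreteTopology Γ] (hd : ∀ j, DiscreteTopology (Γs j))
    (htf : ∀ j, ∀ g ∈ Γs j, IsOfFinOrder g → g = 1) (hconv : ConvergesGeometrically Γs Γ)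
    (hlim : SetsConverge (fun j => limitSet (OnePoint ℂ) (Γs j)) (limitSet (OnePoint ℂ) Γ))
    (hΛ : (limitSet (OnePoint ℂ) Γ).Nontrivial) {γ : PSL(2, ℂ)} (hγ : ∀ j, γ ∈ Γs j)
    {c K : Set (OnePoint ℂ)} (hne : c.Nonempty) (hγc : γ • c = c)
    (hcΛ : Disjoint c (limitSet (OnePoint ℂ) Γ)) (hK : IsCompact K) (hKc : K ⊆ c)
    (hKγ : ∀ x ∈ c, ∃ n : ℤ, γ ^ n • x ∈ K)
    (hinv : ∀ g ∈ Γ, ∀ x ∈ c, g • x ∈ c → g ∈ Subgroup.zpowers γ) :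
    ∀ᶠ j in atTop, c ⊆ domainOfDiscontinuity (OnePoint ℂ) (Γs j) ∧
      IsPreciselyInvariant c (Subgroup.zpowers γ) (Γs j) := by
  have hpow : ∀ j, ∀ n : ℤ, γ ^ n ∈ Γs j := fun j n => (Γs j).zpow_mem (hγ j) n
  have hΩ : ∀ᶠ j in atTop, c ⊆ domainOfDiscontinuity (OnePoint ℂ) (Γs j) := by
    filter_upwards [eventually_subset_domainOfDiscontinuity hlim hΛ.nonempty hK
      (hcΛ.mono_left hKc)] with j hj x hx
    obtain ⟨n, hn⟩ := hKγ x hx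
    simpa using smul_mem_domainOfDiscontinuity ((Γs j).inv_mem (hpow j n)) (hj hn)
  have hgood : ∀ᶠ j in atTop, ∀ g ∈ Γs j, ∀ x ∈ c, g • x ∈ c → g ∈ Subgroup.zpowers γ := by
    by_contra hcon
    obtain ⟨U, hU, hbad⟩ := exists_ultrafilter_of_frequently (not_eventually.1 hcon)
    -- Multiplying by powers of `γ` on both sides moves the two points into `K`.
    have hex : ∀ j, ∃ (A : SL(2, ℂ)) (x : OnePoint ℂ),
        (QuotientGroup.mk A : PSL(2, ℂ)) ∈ Γs j ∧
        ((¬ ∀ g ∈ Γs j, ∀ x ∈ c, g • x ∈ c → g ∈ Subgroup.zpowers γ) →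
          (QuotientGroup.mk A : PSL(2, ℂ)) ∉ Subgroup.zpowers γ ∧ x ∈ K ∧
            (QuotientGroup.mk A : PSL(2, ℂ)) • x ∈ K) := by
      intro j
      by_cases hj : ∀ g ∈ Γs j, ∀ x ∈ c, g • x ∈ c → g ∈ Subgroup.zpowers γ
      · exact ⟨1, OnePoint.infty, (Γs j).one_mem, fun h => absurd hj h⟩
      have hj' := hj
      push Not at hj'
      obtain ⟨g, hg, x, hx, hgx, hgγ⟩ := hj'
      obtain ⟨n, hn⟩ := hKγ x hx
      obtain ⟨m, hm⟩ := hKγ _ hgx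
      obtain ⟨A, hA⟩ := QuotientGroup.mk_surjective (γ ^ m * g * (γ ^ n)⁻¹)
      refine ⟨A, γ ^ n • x, ?_, fun _ => ⟨?_, hn, ?_⟩⟩
      · erw [hA]
        exact (Γs j).mul_mem ((Γs j).mul_mem (hpow j m) hg) ((Γs j).inv_mem (hpow j n))
      · erw [hA]
        rw [Subgroup.mul_mem_cancel_right _ (inv_mem (Subgroup.zpow_mem_zpowers γ n)),
          Subgroup.mul_mem_cancel_left _ (Subgroup.zpow_mem_zpowers γ m)]
        exact hgγ
      · erw [hA]
        rwa [mul_smul, inv_smul_smul, mul_smul]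
    choose A x hA hAx using hex
    have hAU := hbad.mono hAx
    obtain ⟨x₀, hx₀, hx⟩ := hK.exists_tendsto_ultrafilter (hAU.mono fun j hj => hj.2.1)
    obtain ⟨y₀, hy₀, hy⟩ := hK.exists_tendsto_ultrafilter (hAU.mono fun j hj => hj.2.2)
    obtain ⟨g, hg⟩ := exists_tendsto_mk_of_not_tendsto_norm
      (not_tendsto_norm_atTop hlim hΛ hU hA hx hy
        (fun h => hcΛ.le_bot ⟨hKc hx₀, h⟩) (fun h => hcΛ.le_bot ⟨hKc hy₀, h⟩))
    have hgΓ : g ∈ Γ := hconv.mem_of_tendsto (fun j => ⟨1, (Γs j).one_mem⟩) hU (.of_forall hA) hg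
    have hgx : g • x₀ = y₀ := tendsto_nhds_unique (hg.smul hx) hy
    obtain ⟨n, hn⟩ := Subgroup.mem_zpowers_iff.1
      (hinv g hgΓ x₀ (hKc hx₀) (hgx ▸ hKc hy₀))
    have hone : Tendsto (fun j => (γ ^ n)⁻¹ * (QuotientGroup.mk (A j) : PSL(2, ℂ))) U (𝓝 1) := by
      have := hg.const_mul (γ ^ n)⁻¹
      rwa [hn, inv_mul_cancel, ← hn] at this
    obtain ⟨j, hj, hj'⟩ := ((eventually_eq_one_of_tendsto_one hd htf hconv hU
      (fun j => (Γs j).mul_mem ((Γs j).inv_mem (hpow j n)) (hA j)) hone).and hAU).exists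
    refine hj'.1 ?_
    rw [← inv_mul_eq_one.1 hj]
    exact Subgroup.zpow_mem_zpowers γ n
  filter_upwards [hΩ, hgood] with j hj hj'
  refine ⟨hj, le_antisymm ?_ ?_, fun g hg hgγ => ?_⟩
  · rintro g ⟨hg, hgc⟩
    obtain ⟨x, hx⟩ := hne
    have hgc : g • c = c := hgc
    exact hj' g hg x hx (hgc.subset (Set.smul_mem_smul_set hx))
  · rw [Subgroup.zpowers_le]
    exact ⟨hγ j, hγc⟩
  · rw [Set.eq_empty_iff_forall_notMem]
    rintro _ ⟨hy, x, hx, rfl⟩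
    exact hgγ (hj' g hg x hx hy)

/-! ### Cusp regions in approximating groups -/

/-- The part of an invariant Jordan curve outside the fixed points of `γ` is covered by the
translates of a compact subset under the powers of `γ`, provided that `γ` has a single fixed point
in the ambient space. -/
lemma IsJordanCurve.exists_isCompact_zpow_smul_mem {M X : Type*} [Group M] [MulAction M X]
    [TopologicalSpace X] [T2Space X] [ContinuousConstSMul M X] {C : Set X} (hC : IsJordanCurve C)
    {γ : M} {p : X} (hp : MulAction.fixedBy X γ = {p}) (hγ : γ • C = C) :
    ∃ K ⊆ C \ {p}, IsCompact K ∧ ∀ x ∈ C \ {p}, ∃ n : ℤ, γ ^ n • x ∈ K := by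
  obtain ⟨f, hf, hinj, rfl⟩ := hC
  by_cases hpC : p ∈ Set.range f
  · obtain ⟨t, rfl⟩ := hpC
    obtain ⟨e, he, hr⟩ := exists_isEmbedding_real_circle t
    have hemb : IsEmbedding (f ∘ e) := (hf.isClosedEmbedding hinj).isEmbedding.comp he
    have hrange : Set.range (f ∘ e) = Set.range f \ {f t} := by
      rw [Set.range_comp, hr, Set.compl_eq_univ_sdiff, Set.image_sdiff hinj, Set.image_univ,
        Set.image_singleton]
    have hfp : γ • f t = f t := MulAction.mem_fixedBy.1 (hp ▸ rfl)
    rw [← hrange]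
    refine _root_.exists_isCompact_zpow_smul_mem hemb ?_ fun s hs => ?_
    · rw [hrange, Set.smul_set_sdiff, hγ, Set.smul_set_singleton, hfp]
    · have h1 : (f ∘ e) s ∈ Set.range f \ {f t} := hrange ▸ Set.mem_range_self s
      exact h1.2 (hp ▸ MulAction.mem_fixedBy.2 hs)
  · rw [Set.sdiff_singleton_eq_self hpC]
    exact ⟨_, subset_rfl, isCompact_range hf, fun x hx => ⟨0, by simpa using hx⟩⟩

lemma IsJordanCurve.sdiff_singleton_nonempty {X : Type*} [TopologicalSpace X] {C : Set X}
    (hC : IsJordanCurve C) (p : X) : (C \ {p}).Nonempty := by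
  obtain ⟨f, -, hinj, rfl⟩ := hC
  by_cases h : f 1 = p
  · exact ⟨f (-1), ⟨_, rfl⟩, fun h' => by
      have : (-1 : Circle) = 1 := hinj (h'.trans h.symm)
      have h2 : (-1 : ℂ) = 1 := by simpa using congrArg (fun z : Circle => (z : ℂ)) this
      norm_num at h2⟩
  · exact ⟨f 1, ⟨_, rfl⟩, h⟩

lemma discreteTopology_conj_smul {M : Type*} [Group M] [TopologicalSpace M] [IsTopologicalGroup M]
    (β : M) (Γ : Subgroup M) [DiscreteTopology Γ] :
    DiscreteTopology (MulAut.conj β • Γ : Subgroup M) := by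
  refine DiscreteTopology.of_continuous_injective (β := Γ)
    (f := fun γ => ⟨β⁻¹ * γ * β, inv_mul_mul_mem_of_mem_conj_smul γ.2⟩) ?_ fun a b hab => ?_
  · exact Continuous.subtype_mk (by fun_prop) _
  · exact Subtype.ext (mul_left_cancel (mul_right_cancel (congrArg Subtype.val hab)))

theorem mainTheorem9 {G : Type*} [Group G] (hfg : Group.FG G)
    (htf : ∀ g : G, IsOfFinOrder g → g = 1) (hna : ¬ ∀ a b : G, a * b = b * a)
    (ρ : G →* PSL(2, ℂ)) (hρ : ρ ∈ discreteFaithfulReps G)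
    (ρs : ℕ → G →* PSL(2, ℂ)) (hρs : ∀ j, ρs j ∈ discreteFaithfulReps G)
    (htype : IsTypePreserving ρs ρ) (hstrong : ConvergesStrongly ρs ρ)
    (hlim : SetsConverge (fun j => limitSet (OnePoint ℂ) (ρs j).range)
      (limitSet (OnePoint ℂ) ρ.range))
    (h : G) (hprim : IsPrimitiveIn (ρ h) ρ.range)
    (D : Set (OnePoint ℂ)) (hD : IsCuspRegion D (ρ h) ρ.range)
    (ρs' : ℕ → G →* PSL(2, ℂ)) (hnorm : IsNormalizationAbout ρs' ρs ρ h)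
    (c : Set (OnePoint ℂ)) (hc : c = frontier D ∩ domainOfDiscontinuity (OnePoint ℂ) ρ.range) :
    ∀ᶠ j in atTop,
      c ⊆ domainOfDiscontinuity (OnePoint ℂ) (ρs' j).range ∧
        IsPreciselyInvariant c (Subgroup.zpowers (ρs' j h)) (ρs' j).range := by
  obtain ⟨β, hβ, hconj, hh⟩ := hnorm
  have hrange : ∀ j, (ρs' j).range = MulAut.conj (β j) • (ρs j).range := by
    intro j
    ext x
    rw [Subgroup.mem_smul_pointwise_iff_exists]
    constructor
    · rintro ⟨g, rfl⟩
      exact ⟨ρs j g, ⟨g, rfl⟩, (hconj j g).symm⟩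
    · rintro ⟨_, ⟨g, rfl⟩, rfl⟩
      exact ⟨g, hconj j g⟩
  have hdisc : DiscreteTopology ρ.range := hρ.2
  have hdiscs : ∀ j, DiscreteTopology (ρs' j).range := fun j => by
    have := (hρs j).2
    rw [hrange j]
    exact discreteTopology_conj_smul (β j) _
  have htfρ : ∀ σ : G →* PSL(2, ℂ), Function.Injective σ →
      ∀ g ∈ σ.range, IsOfFinOrder g → g = 1 := by
    rintro σ hσ _ ⟨g, rfl⟩ hg
    rw [htf g (hσ.isOfFinOrder_iff.1 hg), map_one]
  have hinj : ∀ j, Function.Injective (ρs' j) := fun j a b hab =>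
    (hρs j).1 (by simpa [hconj] using hab)
  have hgeom : ConvergesGeometrically (fun j => (ρs' j).range) ρ.range := by
    have := hstrong.2.image_of_tendsto (fun b x => b * x * b⁻¹) (fun b x => b⁻¹ * x * b)
      (by fun_prop) (by fun_prop) hβ (by ext; simp) (by ext; simp) (fun j x => by group)
    refine (congrArg (SetsConverge · _) (funext fun j => ?_)).mp this
    exact (congrArg SetLike.coe (hrange j)).symm
  have hlim' : SetsConverge (fun j => limitSet (OnePoint ℂ) (ρs' j).range)
      (limitSet (OnePoint ℂ) ρ.range) := by
    have := hlim.image_of_tendsto (fun (b : PSL(2, ℂ)) x => b • x) (fun b x => b⁻¹ • x)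
      (by fun_prop) (by fun_prop) hβ (by ext; simp) (by ext; simp) (fun j x => by simp)
    refine (congrArg (SetsConverge · _) (funext fun j => ?_)).mp this
    exact ((congrArg (limitSet (OnePoint ℂ)) (hrange j)).trans (limitSet_conj _ _)).symm
  obtain ⟨p, hp⟩ := hD.parabolic.exists_fixedBy_eq_singleton
  have hDΛ : D ∩ limitSet (OnePoint ℂ) ρ.range = {p} := hD.inter_limitSet.trans hp
  have hpΛ : p ∈ limitSet (OnePoint ℂ) ρ.range := (hDΛ.symm ▸ rfl : p ∈ D ∩ _).2
  obtain ⟨x, hx, hxp⟩ := exists_mem_limitSet_ne (htfρ ρ hρ.1) (fun hcomm => hna fun a b =>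
    hρ.1 (by simpa using hcomm _ ⟨a, rfl⟩ _ ⟨b, rfl⟩)) hpΛ
  have hDclosed : IsClosed D := by
    rw [← hD.jordan.1]
    exact isClosed_closure
  have hfrD : frontier D ⊆ D := hDclosed.frontier_subset
  -- The boundary of `D` meets the limit set at most in `p`.
  have hcp : c = frontier D \ {p} := by
    rw [hc, ← hDΛ]
    ext z
    simp only [limitSet, Set.mem_inter_iff, Set.mem_sdiff, Set.mem_compl_iff]
    exact ⟨fun hz => ⟨hz.1, fun hz' => hz'.2 hz.2⟩,
      fun hz => ⟨hz.1, by_contra fun hz' => hz.2 ⟨hfrD hz.1, hz'⟩⟩⟩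
  have hγD : ρ h • D = D :=
    (hD.preciselyInvariant.1.ge (Subgroup.mem_zpowers (ρ h))).2
  have hγfr : ρ h • frontier D = frontier D := by
    have := (Homeomorph.smul (ρ h)).image_frontier D
    change ρ h • frontier D = frontier (ρ h • D) at this
    rwa [hγD] at this
  have hγp : ρ h • p = p := MulAction.mem_fixedBy.1 (hp ▸ rfl)
  obtain ⟨K, hKc, hK, hKγ⟩ := hD.jordan.2.2.exists_isCompact_zpow_smul_mem hp hγfr
  simp only [hh]
  refine eventually_isPreciselyInvariant (Γ := ρ.range) hdiscs (fun j => htfρ _ (hinj j)) hgeom hlim'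
    ⟨x, hx, p, hpΛ, hxp⟩ (fun j => ⟨h, hh j⟩)
    (hcp ▸ hD.jordan.2.2.sdiff_singleton_nonempty p) ?_ ?_ hK (hcp ▸ hKc) (hcp ▸ hKγ) ?_
  · rw [hcp, Set.smul_set_sdiff, hγfr, Set.smul_set_singleton, hγp]
  · rw [hc, limitSet]
    exact Set.disjoint_compl_right_iff_subset.2 Set.inter_subset_right
  · intro g hg y hy hgy
    by_contra hgγ
    have hcD : c ⊆ D := hc ▸ Set.inter_subset_left.trans hfrD
    exact (hD.preciselyInvariant.2 g hg hgγ).subset ⟨hcD hgy, Set.smul_mem_smul_set (hcD hy)⟩
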